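/- A \emph{priced timed Petri net (PTPN)} consists of a finite set $Q$ of control-states, a finite set $P$ of places, a finite set $T$ of transitions $t=(q_1,q_2,\mathit{In},\mathit{Read},\mathit{Out})$, where $q_1,q_2\in Q$ and $\mathit{In},\mathit{Read},\mathit{Out}$ are finite multisets over $P\times\mathit{Intrv}$, and a cost function $\mathrm{Cost}:P\cup T\to\mathbb N$. Here $\mathit{Intrv}$ is the set of (open, closed, half-open) intervals with left end in $\mathbb N$ and right end in $\mathbb N\cup\{\infty\}$. A marking is a finite multiset $M$ over $P\times\mathbb R_{\ge0}$ (tokens with their ages); a configuration $c=(q,M)$ is a control-state with a marking, and $|c|$ is the number of its tokens. A timed step with delay $x>0$ goes from $(q,M)$ to $(q,M^{+x})$, where $M^{+x}$ is $M$ with all ages increased by $x$, and costs $x\sum_{p\in P}|M(p)|\,\mathrm{Cost}(p)$, where $|M(p)|$ is the number of tokens on $p$. A discrete step with $t$ as above goes from $(q_1,I+R+M)$ to $(q_2,O+R+M)$, where $I$, $R$, $O$ match $\mathit{In}$, $\mathit{Read}$, $\mathit{Out}$ respectively (there is a bijection from tokens to arcs that respects places and puts each age in the interval of its arc); its cost is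 $\mathrm{Cost}(t)$, and $O$ is the multiset of its new tokens. A computation is a finite sequence of steps; its length is the number of steps and its cost is the sum of their costs. Given $q_{\mathrm{init}},q_{\mathrm{fin}}\in Q$, a computation is called \emph{reaching} if it starts in $(q_{\mathrm{init}},\emptyset)$ and ends in a configuration with control-state $q_{\mathrm{fin}}$, and $\mathrm{OptCost}$ is the infimum of the costs of all reaching computations ($\infty$ if there are none). A timed step from $(q,M)$ with delay $x$ is \emph{detailed} if, with $\varepsilon$ the largest fractional part of a token age in $M$ ($\varepsilon=0$ if $M=\emptyset$), either $0<x<1-\varepsilon$ (no token reaches the next integer age), or $M\ne\emptyset$, no token of $M$ has integer age, and $x=1-\varepsilon$ (exactly the tokens with the largest fractional part reach the next integer age). A computation is detailed if all its timed steps are; all delays are then $<1$. For $\delta>0$, a computation is in \emph{$\delta$-form} if each age $y$ of a new token of a discrete step has fractional part $\mathrm{frac}(y)<\delta$ or $\mathrm{frac}(y)>1-\delta$, and each delay lies in $(0,\delta)\cup(1-\delta,1)$. It is in \emph{long $\delta$-form} if the same holds for the ages of the new tokens and each delay $x>0$ satisfies $\mathrm{frac}(x)<\delta$ or $\mathrm{frac}(x)>1-\delta$.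 \textbf{Statement.} Let a PTPN, $q_{\mathrm{init}},q_{\mathrm{fin}}\in Q$ and $\delta>0$ be given. (1) For every reaching computation $\pi=(c_0\to\dots\to c_n)$ there is a reaching computation $\pi'=(c'_0\to\dots\to c'_n)$ of the same length, in long $\delta$-form, with $\mathrm{Cost}(\pi')\le\mathrm{Cost}(\pi)$ and $|c'_i|=|c_i|$ for all $0\le i\le n$, such that $\pi'$ is in $\delta$-form if all delays of $\pi$ are $<1$ (in particular if $\pi$ is detailed), and $\pi'$ is detailed if $\pi$ is detailed. (2) $\mathrm{OptCost}=\inf\{\mathrm{Cost}(\pi) : \pi \text{ is a reaching computation in } \delta\text{-form}\}$. -/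

import Mathlib

open scoped NNReal ENNReal

namespace PTPN

/-- Time intervals with a left end in `ℕ` and a right end in `ℕ ∪ {∞}`, each of the two sides being
either open or closed. -/
structure Intrv where
  lo : ℕ
  hi : ℕ∞
  loClosed : Bool
  hiClosed : Bool

/-- `i.Mem x`: the age `x` lies in the interval `i` (an infinite right end imposes nothing). -/
def Intrv.Mem (i : Intrv) (x : ℝ≥0) : Prop :=
  (if i.loClosed then (i.lo : ℝ≥0) ≤ x else (i.lo : ℝ≥0) < x) ∧
  ∀ b : ℕ, i.hi = (b : ℕ∞) → if i.hiClosed then x ≤ (b : ℝ≥0) else x < (b : ℝ≥0)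

/-- A marking: a finite multiset of tokens; a token is a place with an age. -/
abbrev Marking (P : Type*) := Multiset (P × ℝ≥0)

/-- A configuration: a control-state with a marking. -/
abbrev Config (Q P : Type*) := Q × Marking P

/-- A transition `(q₁, q₂, In, Read, Out)`. -/
structure Transition (Q P : Type*) where
  src : Q
  tgt : Q
  inp : Multiset (P × Intrv)
  read : Multiset (P × Intrv)
  out : Multiset (P × Intrv)

/-- A priced timed Petri net with control-states `Q` and places `P` (finiteness of `Q` and `P` is
required where nets are used). -/
structure Net (Q P : Type*) where
  T : Finset (Transition Q P)
  placeCost : P → ℕ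
  transCost : T → ℕ

variable {Q P : Type*}

/-- There is a bijection from the tokens of `M` to the arcs of `α` that respects the places and
sends each token to an arc whose interval contains the age of the token. -/
def Matches (M : Marking P) (α : Multiset (P × Intrv)) : Prop :=
  Multiset.Rel (fun tok arc => tok.1 = arc.1 ∧ arc.2.Mem tok.2) M α

/-- `M^{+x}`: all tokens get older by `x`. -/
def Marking.age (M : Marking P) (x : ℝ≥0) : Marking P :=
  M.map fun tok => (tok.1, tok.2 + x)

/-- What happens in one step: an occurrence of a discrete transition `t` that produces the tokens
`O`, or a delay `x`. -/
inductive Label (N : Net Q P) where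
  | disc (t : N.T) (O : Marking P)
  | delay (x : ℝ≥0)

/-- The step relation of the net. -/
def Step (N : Net Q P) (c : Config Q P) : Label N → Config Q P → Prop
  | .disc t O, c' =>
      c.1 = t.1.src ∧ c'.1 = t.1.tgt ∧
      ∃ I R M : Marking P,
        c.2 = I + R + M ∧
        Matches I t.1.inp ∧ Matches R t.1.read ∧ Matches O t.1.out ∧
        c'.2 = O + R + M
  | .delay x, c' => 0 < x ∧ c'.1 = c.1 ∧ c'.2 = c.2.age x

/-- The cost of a step that is taken from the configuration `c`. -/
def stepCost [Fintype P] [DecidableEq P] (N : Net Q P) (c : Config Q P) : Label N → ℝ≥0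
  | .disc t _ => (N.transCost t : ℝ≥0)
  | .delay x =>
      x * ∑ p : P, (c.2.countP (fun tok => tok.1 = p) : ℝ≥0) * (N.placeCost p : ℝ≥0)

/-- The computations with `n` steps. -/
structure Computation (N : Net Q P) (n : ℕ) where
  conf : Fin (n + 1) → Config Q P
  label : Fin n → Label N
  step : ∀ i : Fin n, Step N (conf i.castSucc) (label i) (conf i.succ)

/-- The computation leads from `(qinit, ∅)` to some configuration with control-state `qfin`. -/
def Computation.Reaches {N : Net Q P} {n : ℕ} (π : Computation N n) (qinit qfin : Q) : Prop :=
  π.conf 0 = (qinit, 0) ∧ (π.conf (Fin.last n)).1 = qfin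

/-- The cost of a computation. -/
def Computation.cost [Fintype P] [DecidableEq P] {N : Net Q P} {n : ℕ}
    (π : Computation N n) : ℝ≥0 :=
  ∑ i : Fin n, stepCost N (π.conf i.castSucc) (π.label i)

/-- The infimum of all `v` such that some computation from `(qinit, ∅)` to the control-state `qfin`
has cost at most `v`; it is `∞` if there is no such computation. -/
noncomputable def optCost [Fintype P] [DecidableEq P] (N : Net Q P) (qinit qfin : Q) : ℝ≥0∞ :=
  sInf {v : ℝ≥0∞ | ∃ (n : ℕ) (π : Computation N n), π.Reaches qinit qfin ∧ (π.cost : ℝ≥0∞) ≤ v}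

/-- The fractional part of a nonnegative real. -/
noncomputable def frac (x : ℝ≥0) : ℝ := Int.fract (x : ℝ)

/-- `x` has a fractional part below `δ` or above `1 - δ`. -/
def NearInt (δ : ℝ) (x : ℝ≥0) : Prop := frac x < δ ∨ 1 - δ < frac x

/-- A marking in `δ`-form: the age of every token is close to an integer. -/
def Marking.IsDeltaForm (δ : ℝ) (M : Marking P) : Prop := ∀ tok ∈ M, NearInt δ tok.2

/-- A computation in `δ`-form: the tokens produced by each occurrence of a discrete transition are
in `δ`-form, and each delay is in `(0, δ)` or in `(1 - δ, 1)`. -/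
def Computation.IsDeltaForm (δ : ℝ) {N : Net Q P} {n : ℕ} (π : Computation N n) : Prop :=
  (∀ i t O, π.label i = .disc t O → O.IsDeltaForm δ) ∧
  ∀ i x, π.label i = .delay x →
    (0 < (x : ℝ) ∧ (x : ℝ) < δ) ∨ (1 - δ < (x : ℝ) ∧ (x : ℝ) < 1)

/-- The variant of the `δ`-form for computations with delays of arbitrary length: the delays are
close to arbitrary integers, not only to `0` from above or to `1` from below. -/
def Computation.IsLongDeltaForm (δ : ℝ) {N : Net Q P} {n : ℕ} (π : Computation N n) : Prop :=
  (∀ i t O, π.label i = .disc t O → O.IsDeltaForm δ) ∧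
  ∀ i x, π.label i = .delay x → NearInt δ x

/-- The delay `x` is detailed for `M`. With `ε` the largest fractional part of a token age in `M`
(`ε = 0` if `M` is empty) this says that `0 < x < 1 - ε` (no token reaches the next integer age),
or that `M` is nonempty and has no token of integer age and `x = 1 - ε` (exactly the tokens with
the largest fractional part reach the next integer age). -/
def DetailedDelay (M : Marking P) (x : ℝ≥0) : Prop :=
  ∃ ε : ℝ, IsGreatest (insert 0 {r : ℝ | ∃ tok ∈ M, frac tok.2 = r}) ε ∧
    ((0 < (x : ℝ) ∧ (x : ℝ) < 1 - ε) ∨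
      (M ≠ 0 ∧ (∀ tok ∈ M, frac tok.2 ≠ 0) ∧ (x : ℝ) = 1 - ε))

/-- A computation is detailed if all its timed steps are. -/
def Computation.Detailed {N : Net Q P} {n : ℕ} (π : Computation N n) : Prop :=
  ∀ i x, π.label i = .delay x → DetailedDelay (π.conf i.castSucc).2 x

/-- All delays of the computation are shorter than one time unit. -/
def Computation.ShortDelays {N : Net Q P} {n : ℕ} (π : Computation N n) : Prop :=
  ∀ i x, π.label i = .delay x → x < 1

end PTPN

/-! Reparametrize time by a strictly increasing `g : ℝ → ℝ` with `g (z + 1) = g z + 1`. A token of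
age `a` at time `t` has birth time `t - a`, possibly negative, and gets the new age `g t - g (t -
a)`. Since `g` commutes with integer shifts, old and new ages compare in the same way with every
integer. So interval membership, detailedness and delays below 1 survive (`mem_reage`,
`DetailedDelay.reage`), and computations are sent to computations with the same token counts.

The cost is affine in the increments of `g` between step times (`Computation.exists_cost_reage_eq`).
Rounding at a threshold `θ` is monotone, commutes with integer shifts, and averages to the identity
over `θ ∈ [0, 1)`. Hence some `θ` does not increase the cost (`exists_sum_thresholdRound_le`).
Rounding is not strictly increasing, so `g` is taken as `s * id + (1 - s) * rounding` with small `s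
> 0`: the cost bound persists by convexity, and all differences of values of `g` are within `2 * s`
of integers.

For the infimum, long delays are first cut into equal pieces shorter than 1, at the same total cost.
-/

namespace PTPN

variable {Q P : Type*}

/-! ### Reparametrized ages -/

/-- The age at time `g t` of a token that has age `a` at time `t`, once time is reparametrized
by `g`. -/
noncomputable def reage (g : CircleDeg1Lift) (t a : ℝ≥0) : ℝ≥0 :=
  Real.toNNReal (g t - g ((t : ℝ) - a))

theorem coe_reage (g : CircleDeg1Lift) (t a : ℝ≥0) :
    (reage g t a : ℝ) = g t - g ((t : ℝ) - a) :=
  Real.coe_toNNReal _ (sub_nonneg.2 (g.monotone (sub_le_self _ a.2)))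

/-- The new age is below `n` iff `g t < g (t - a) + n = g (t - a + n)`, and a strictly monotone `g`
can be cancelled. -/
theorem reage_lt_natCast {g : CircleDeg1Lift} (hg : StrictMono g) (t a : ℝ≥0) (n : ℕ) :
    reage g t a < n ↔ a < n := by
  have h : g t < g ((t : ℝ) - a + n) ↔ (t : ℝ) < t - a + n := hg.lt_iff_lt
  rw [g.map_add_nat] at h
  rw [← NNReal.coe_lt_coe, ← NNReal.coe_lt_coe, coe_reage, NNReal.coe_natCast]
  constructor <;> intro h'
  · linarith [h.1 (by linarith)]
  · linarith [h.2 (by linarith)]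

theorem natCast_lt_reage {g : CircleDeg1Lift} (hg : StrictMono g) (t a : ℝ≥0) (n : ℕ) :
    n < reage g t a ↔ n < a := by
  have h : g ((t : ℝ) - a + n) < g t ↔ (t : ℝ) - a + n < t := hg.lt_iff_lt
  rw [g.map_add_nat] at h
  rw [← NNReal.coe_lt_coe, ← NNReal.coe_lt_coe, coe_reage, NNReal.coe_natCast]
  constructor <;> intro h'
  · linarith [h.1 (by linarith)]
  · linarith [h.2 (by linarith)]

theorem natCast_le_reage {g : CircleDeg1Lift} (hg : StrictMono g) (t a : ℝ≥0) (n : ℕ) :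
    n ≤ reage g t a ↔ n ≤ a := by
  simpa only [not_lt] using not_congr (reage_lt_natCast hg t a n)

theorem reage_le_natCast {g : CircleDeg1Lift} (hg : StrictMono g) (t a : ℝ≥0) (n : ℕ) :
    reage g t a ≤ n ↔ a ≤ n := by
  simpa only [not_lt] using not_congr (natCast_lt_reage hg t a n)

theorem reage_eq_natCast {g : CircleDeg1Lift} (hg : StrictMono g) (t a : ℝ≥0) (n : ℕ) :
    reage g t a = n ↔ a = n := by
  rw [le_antisymm_iff, le_antisymm_iff, reage_le_natCast hg, natCast_le_reage hg]

theorem mem_reage {g : CircleDeg1Lift} (hg : StrictMono g) (t : ℝ≥0) {i : Intrv} {a : ℝ≥0}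
    (h : i.Mem a) : i.Mem (reage g t a) := by
  unfold Intrv.Mem at h ⊢
  simpa only [natCast_le_reage hg, natCast_lt_reage hg, reage_le_natCast hg,
    reage_lt_natCast hg] using h

/-- During a delay `x`, a reparametrized token ages by the reparametrized delay
`reage g (t + x) x`. -/
theorem reage_add (g : CircleDeg1Lift) (t a x : ℝ≥0) :
    reage g (t + x) (a + x) = reage g t a + reage g (t + x) x := by
  rw [← NNReal.coe_inj, NNReal.coe_add]
  simp only [coe_reage, NNReal.coe_add, add_sub_cancel_right, add_sub_add_right_eq_sub]
  ring

theorem nearInt_of_abs_sub_lt {δ : ℝ} {x : ℝ≥0} {n : ℤ} (h : |(x : ℝ) - n| < δ) :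
    NearInt δ x := by
  rw [abs_lt] at h
  have hf := Int.self_sub_floor (x : ℝ)
  rcases le_or_gt n ⌊(x : ℝ)⌋ with hn | hn
  · left
    have : (n : ℝ) ≤ ⌊(x : ℝ)⌋ := by exact_mod_cast hn
    unfold frac
    linarith
  · right
    have : (⌊(x : ℝ)⌋ : ℝ) + 1 ≤ n := by exact_mod_cast hn
    unfold frac
    linarith

theorem nearInt_reage {δ : ℝ} {g : CircleDeg1Lift}
    (hg : ∀ z w, ∃ n : ℤ, |g z - g w - n| < δ) (t a : ℝ≥0) : NearInt δ (reage g t a) := by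
  obtain ⟨n, hn⟩ := hg t ((t : ℝ) - a)
  exact nearInt_of_abs_sub_lt (n := n) (by rwa [coe_reage])

/-! ### Reparametrized markings -/

/-- The marking at time `g t` that corresponds to the marking `M` at time `t`. -/
noncomputable def Marking.reage (g : CircleDeg1Lift) (t : ℝ≥0) (M : Marking P) : Marking P :=
  M.map fun tok => (tok.1, PTPN.reage g t tok.2)

theorem Matches.reage {g : CircleDeg1Lift} (hg : StrictMono g) (t : ℝ≥0) {M : Marking P}
    {α : Multiset (P × Intrv)} (h : Matches M α) : Matches (M.reage g t) α := by
  unfold Matches Marking.reage at *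
  rw [Multiset.rel_map_left]
  exact h.mono fun _ _ _ _ h => ⟨h.1, mem_reage hg t h.2⟩

theorem Marking.reage_add (g : CircleDeg1Lift) (t : ℝ≥0) (M N : Marking P) :
    Marking.reage g t (M + N) = M.reage g t + N.reage g t :=
  Multiset.map_add _ _ _

theorem Marking.card_reage (g : CircleDeg1Lift) (t : ℝ≥0) (M : Marking P) :
    (M.reage g t).card = M.card :=
  Multiset.card_map _ _

theorem Marking.age_reage (g : CircleDeg1Lift) (t x : ℝ≥0) (M : Marking P) :
    (M.age x).reage g (t + x) = (M.reage g t).age (PTPN.reage g (t + x) x) := by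
  simp only [Marking.age, Marking.reage, Multiset.map_map]
  exact Multiset.map_congr rfl fun tok _ => Prod.ext rfl (PTPN.reage_add g t tok.2 x)

theorem Marking.age_age (M : Marking P) (x y : ℝ≥0) : (M.age x).age y = M.age (x + y) := by
  simp only [Marking.age, Multiset.map_map, Function.comp_def, add_assoc]

theorem Marking.countP_age [DecidableEq P] (M : Marking P) (x : ℝ≥0) (p : P) :
    (M.age x).countP (fun tok => tok.1 = p) = M.countP (fun tok => tok.1 = p) := by
  rw [Marking.age, Multiset.countP_map, ← Multiset.countP_eq_card_filter]

theorem Marking.countP_reage [DecidableEq P] (g : CircleDeg1Lift) (t : ℝ≥0) (M : Marking P)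
    (p : P) :
    (M.reage g t).countP (fun tok => tok.1 = p) = M.countP (fun tok => tok.1 = p) := by
  rw [Marking.reage, Multiset.countP_map, ← Multiset.countP_eq_card_filter]

/-! ### Detailed delays in terms of comparisons with integers -/

theorem exists_isGreatest_frac (M : Marking P) :
    ∃ ε : ℝ, IsGreatest (insert 0 {r : ℝ | ∃ tok ∈ M, frac tok.2 = r}) ε := by
  classical
  have hf : (insert 0 {r : ℝ | ∃ tok ∈ M, frac tok.2 = r}).Finite := by
    refine Set.Finite.insert _ ((M.toFinset.finite_toSet.image fun tok => frac tok.2).subset ?_)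
    rintro r ⟨tok, htok, rfl⟩
    exact ⟨tok, by simpa using htok, rfl⟩
  exact hf.isCompact.exists_isGreatest (Set.insert_nonempty _ _)

theorem frac_eq_sub {a : ℝ≥0} {n : ℕ} (h : n ≤ a) (h' : a < (n + 1 : ℕ)) :
    frac a = a - n := by
  rw [← NNReal.coe_le_coe] at h
  rw [← NNReal.coe_lt_coe] at h'
  push_cast at h h'
  have hn : ⌊(a : ℝ)⌋ = n := Int.floor_eq_iff.2 ⟨by exact_mod_cast h, by exact_mod_cast h'⟩
  rw [frac, Int.fract, hn, Int.cast_natCast]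

theorem frac_eq_sub_floor (a : ℝ≥0) : frac a = a - ⌊a⌋₊ :=
  frac_eq_sub (Nat.floor_le zero_le) (by exact_mod_cast Nat.lt_floor_add_one a)

theorem frac_add_lt_one_iff (a x : ℝ≥0) :
    frac a + x < 1 ↔ ∃ n : ℕ, n ≤ a ∧ a + x < (n + 1 : ℕ) := by
  constructor
  · intro h
    refine ⟨⌊a⌋₊, Nat.floor_le zero_le, ?_⟩
    rw [frac_eq_sub_floor] at h
    rw [← NNReal.coe_lt_coe]
    push_cast
    linarith
  · rintro ⟨n, h, h'⟩
    rw [frac_eq_sub h (lt_of_le_of_lt le_self_add h')]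
    rw [← NNReal.coe_lt_coe] at h'
    push_cast at h'
    linarith

theorem frac_add_eq_one_iff {a x : ℝ≥0} (hx : 0 < x) (hx' : x ≤ 1) :
    frac a + x = 1 ↔ ∃ n : ℕ, a + x = (n + 1 : ℕ) := by
  constructor
  · intro h
    refine ⟨⌊a⌋₊, ?_⟩
    rw [frac_eq_sub_floor] at h
    rw [← NNReal.coe_inj]
    push_cast
    linarith
  · rintro ⟨n, h⟩
    rw [← NNReal.coe_inj] at h
    rw [← NNReal.coe_pos] at hx
    rw [← NNReal.coe_le_coe] at hx'
    push_cast at h hx'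
    rw [frac_eq_sub (n := n)]
    · linarith
    · rw [← NNReal.coe_le_coe]
      push_cast
      linarith
    · rw [← NNReal.coe_lt_coe]
      push_cast
      linarith

theorem frac_ne_zero_and_add_le_one_iff {a x : ℝ≥0} (hx : 0 < x) :
    frac a ≠ 0 ∧ frac a + x ≤ 1 ↔ ∃ n : ℕ, n < a ∧ a + x ≤ (n + 1 : ℕ) := by
  constructor
  · rintro ⟨h₀, h⟩
    refine ⟨⌊a⌋₊, (Nat.floor_le zero_le).lt_of_ne fun he => h₀ ?_, ?_⟩
    · rw [frac_eq_sub_floor, sub_eq_zero]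
      exact_mod_cast he.symm
    · rw [frac_eq_sub_floor] at h
      rw [← NNReal.coe_le_coe]
      push_cast
      linarith
  · rintro ⟨n, h, h'⟩
    rw [frac_eq_sub h.le ((lt_add_of_pos_right a hx).trans_le h')]
    rw [← NNReal.coe_lt_coe] at h
    rw [← NNReal.coe_le_coe] at h'
    push_cast at h h'
    exact ⟨by linarith, by linarith⟩

/-- Eliminates fractional parts, which `reage` does not preserve, in favour of integer comparisons
of `x`, `a` and `a + x`, which it does. -/
theorem detailedDelay_iff (M : Marking P) (x : ℝ≥0) :
    DetailedDelay M x ↔ 0 < x ∧ x < 1 ∧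
      ((∀ tok ∈ M, ∃ n : ℕ, n ≤ tok.2 ∧ tok.2 + x < (n + 1 : ℕ)) ∨
        ((∀ tok ∈ M, ∃ n : ℕ, n < tok.2 ∧ tok.2 + x ≤ (n + 1 : ℕ)) ∧
          ∃ tok ∈ M, ∃ n : ℕ, tok.2 + x = (n + 1 : ℕ))) := by
  constructor
  · rintro ⟨ε, ⟨hε, hmax⟩, h⟩
    have hle : ∀ tok ∈ M, frac tok.2 ≤ ε := fun tok htok => hmax (.inr ⟨tok, htok, rfl⟩)
    rcases h with ⟨h₀, h₁⟩ | ⟨hM, h₀, h₁⟩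
    · have hε0 : 0 ≤ ε := hmax (.inl rfl)
      refine ⟨by exact_mod_cast h₀, by rw [← NNReal.coe_lt_coe, NNReal.coe_one]; linarith,
        .inl fun tok htok => (frac_add_lt_one_iff _ _).1 ?_⟩
      linarith [hle tok htok]
    · obtain ⟨tok, htok, rfl⟩ : ∃ tok ∈ M, frac tok.2 = ε := by
        rcases hε with rfl | hε
        · obtain ⟨tok, htok⟩ := Multiset.exists_mem_of_ne_zero hM
          exact absurd ((hle tok htok).antisymm (Int.fract_nonneg _)) (h₀ tok htok)
        · exact hε
      have hx0 : 0 < x := by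
        rw [← NNReal.coe_pos, h₁]
        exact sub_pos.2 (Int.fract_lt_one _)
      have hx1 : x < 1 := by
        rw [← NNReal.coe_lt_coe, h₁, NNReal.coe_one]
        exact sub_lt_self _ ((Int.fract_nonneg _).lt_of_ne (h₀ tok htok).symm)
      refine ⟨hx0, hx1, .inr ⟨fun tok' htok' => (frac_ne_zero_and_add_le_one_iff hx0).1
        ⟨h₀ tok' htok', by linarith [hle tok' htok']⟩, tok, htok,
        (frac_add_eq_one_iff hx0 hx1.le).1 (by linarith)⟩⟩
  · rintro ⟨hx0, hx1, h⟩
    have hx0' : (0 : ℝ) < x := hx0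
    have hx1' : (x : ℝ) < 1 := hx1
    rcases h with h | ⟨h, tok, htok, hn⟩
    · obtain ⟨ε, hε⟩ := exists_isGreatest_frac M
      refine ⟨ε, hε, .inl ⟨hx0', ?_⟩⟩
      rcases hε.1 with rfl | ⟨tok, htok, rfl⟩
      · linarith
      · linarith [(frac_add_lt_one_iff _ _).2 (h tok htok)]
    · have h₁ := (frac_add_eq_one_iff hx0 hx1.le).2 hn
      have h₂ := fun tok htok => (frac_ne_zero_and_add_le_one_iff hx0).2 (h tok htok)
      refine ⟨frac tok.2, ⟨.inr ⟨tok, htok, rfl⟩, ?_⟩, .inr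
        ⟨fun hM => by simp [hM] at htok, fun tok htok => (h₂ tok htok).1, by linarith⟩⟩
      rintro _ (rfl | ⟨tok', htok', rfl⟩)
      · exact Int.fract_nonneg _
      · linarith [(h₂ tok' htok').2]

theorem DetailedDelay.lt_one {M : Marking P} {x : ℝ≥0} (h : DetailedDelay M x) : x < 1 :=
  ((detailedDelay_iff M x).1 h).2.1

theorem DetailedDelay.reage {g : CircleDeg1Lift} (hg : StrictMono g) (t : ℝ≥0) {M : Marking P}
    {x : ℝ≥0} (h : DetailedDelay M x) :
    DetailedDelay (M.reage g t) (PTPN.reage g (t + x) x) := by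
  have h0 := natCast_lt_reage hg (t + x) x 0
  have h1 := reage_lt_natCast hg (t + x) x 1
  rw [Nat.cast_zero] at h0
  rw [Nat.cast_one] at h1
  rw [detailedDelay_iff] at h ⊢
  -- `← PTPN.reage_add` merges new age plus new delay into the new version of `a + x` at time `t +
  -- x`, so that every condition is an integer comparison.
  simp only [Marking.reage, Multiset.mem_map, forall_exists_index, and_imp,
    forall_apply_eq_imp_iff₂, exists_exists_and_eq_and, ← PTPN.reage_add, h0, h1,
    natCast_le_reage hg, natCast_lt_reage hg, reage_le_natCast hg, reage_lt_natCast hg,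
    reage_eq_natCast hg]
  exact h

/-! ### Reparametrized computations -/

/-- The time that passes during a step. -/
def Label.duration {N : Net Q P} : Label N → ℝ≥0
  | .disc _ _ => 0
  | .delay x => x

/-- The step of the reparametrized computation that corresponds to a step taken at time `t`. -/
noncomputable def Label.reage {N : Net Q P} (g : CircleDeg1Lift) (t : ℝ≥0) : Label N → Label N
  | .disc tr O => .disc tr (O.reage g t)
  | .delay x => .delay (PTPN.reage g (t + x) x)

theorem Step.reage {N : Net Q P} {g : CircleDeg1Lift} (hg : StrictMono g) (t : ℝ≥0)
    {c c' : Config Q P} {l : Label N} (h : Step N c l c') :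
    Step N (c.1, c.2.reage g t) (l.reage g t) (c'.1, c'.2.reage g (t + l.duration)) := by
  cases l with
  | disc tr O =>
    obtain ⟨h₁, h₂, I, R, M, hc, hI, hR, hO, hc'⟩ := h
    refine ⟨h₁, h₂, I.reage g t, R.reage g t, M.reage g t, ?_, hI.reage hg t, hR.reage hg t,
      hO.reage hg t, ?_⟩
    · rw [hc, Marking.reage_add, Marking.reage_add]
    · rw [hc', Label.duration, add_zero, Marking.reage_add, Marking.reage_add]
  | delay x =>
    obtain ⟨h₁, h₂, h₃⟩ := h
    -- Comparison with the integer 0 keeps the delay positive.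
    have h0 := natCast_lt_reage hg (t + x) x 0
    rw [Nat.cast_zero] at h0
    exact ⟨h0.2 h₁, h₂, by simp only [h₃, Label.duration, Marking.age_reage]⟩

/-- The time at which each configuration of a computation is reached. -/
def Computation.time {N : Net Q P} {n : ℕ} (π : Computation N n) : Fin (n + 1) → ℝ≥0 :=
  Fin.partialSum fun i => (π.label i).duration

theorem Computation.time_succ {N : Net Q P} {n : ℕ} (π : Computation N n) (i : Fin n) :
    π.time i.succ = π.time i.castSucc + (π.label i).duration :=
  Fin.partialSum_succ _ _

/-- The computation that results from reparametrizing time by `g`. -/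
noncomputable def Computation.reage {N : Net Q P} {n : ℕ} (π : Computation N n)
    {g : CircleDeg1Lift} (hg : StrictMono g) : Computation N n where
  conf i := ((π.conf i).1, (π.conf i).2.reage g (π.time i))
  label i := (π.label i).reage g (π.time i.castSucc)
  step i := by
    rw [π.time_succ]
    exact (π.step i).reage hg _

section

variable {N : Net Q P} {n : ℕ} {π : Computation N n} {g : CircleDeg1Lift} (hg : StrictMono g)

theorem Computation.Reaches.reage {qinit qfin : Q} (h : π.Reaches qinit qfin) :
    (π.reage hg).Reaches qinit qfin :=
  ⟨by simp [Computation.reage, h.1, Marking.reage], h.2⟩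

theorem Computation.label_reage_eq_disc {i : Fin n} {t : N.T} {O : Marking P}
    (h : (π.reage hg).label i = .disc t O) :
    ∃ O', π.label i = .disc t O' ∧ O = O'.reage g (π.time i.castSucc) := by
  change (π.label i).reage g _ = _ at h
  cases hl : π.label i with
  | disc t' O' =>
    rw [hl, Label.reage] at h
    injection h with h₁ h₂
    exact ⟨O', by rw [h₁], h₂.symm⟩
  | delay x => simp [hl, Label.reage] at h

theorem Computation.label_reage_eq_delay {i : Fin n} {x : ℝ≥0}
    (h : (π.reage hg).label i = .delay x) :
    ∃ y, π.label i = .delay y ∧ x = PTPN.reage g (π.time i.castSucc + y) y := by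
  change (π.label i).reage g _ = _ at h
  cases hl : π.label i with
  | disc t' O' => simp [hl, Label.reage] at h
  | delay y =>
    rw [hl, Label.reage] at h
    injection h with h
    exact ⟨y, rfl, h.symm⟩

theorem Computation.ShortDelays.reage (h : π.ShortDelays) : (π.reage hg).ShortDelays := by
  intro i x hx
  obtain ⟨y, hy, rfl⟩ := π.label_reage_eq_delay hg hx
  have h1 := reage_lt_natCast hg (π.time i.castSucc + y) y 1
  rw [Nat.cast_one] at h1
  exact h1.2 (h i y hy)

theorem Computation.Detailed.reage (h : π.Detailed) : (π.reage hg).Detailed := by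
  intro i x hx
  obtain ⟨y, hy, rfl⟩ := π.label_reage_eq_delay hg hx
  exact (h i y hy).reage hg _

theorem Computation.Detailed.shortDelays (h : π.Detailed) : π.ShortDelays :=
  fun i x hx => (h i x hx).lt_one

theorem Computation.isLongDeltaForm_reage {δ : ℝ}
    (hδ : ∀ z w, ∃ n : ℤ, |g z - g w - n| < δ) : (π.reage hg).IsLongDeltaForm δ := by
  refine ⟨fun i t O hO => ?_, fun i x hx => ?_⟩
  · obtain ⟨O', -, rfl⟩ := π.label_reage_eq_disc hg hO
    intro tok htok
    obtain ⟨tok', -, rfl⟩ := Multiset.mem_map.1 htok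
    exact nearInt_reage hδ _ _
  · obtain ⟨y, -, rfl⟩ := π.label_reage_eq_delay hg hx
    exact nearInt_reage hδ _ _

theorem Computation.IsLongDeltaForm.isDeltaForm {δ : ℝ} (h : π.IsLongDeltaForm δ)
    (hs : π.ShortDelays) : π.IsDeltaForm δ := by
  refine ⟨h.1, fun i x hx => ?_⟩
  have h0 : 0 < x := by
    have := π.step i
    rw [hx] at this
    exact this.1
  have h1 : (x : ℝ) < 1 := by exact_mod_cast hs i x hx
  have hfr : frac x = x := Int.fract_eq_self.2 ⟨x.2, h1⟩
  rcases h.2 i x hx with h' | h' <;> rw [hfr] at h'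
  · exact .inl ⟨by exact_mod_cast h0, h'⟩
  · exact .inr ⟨h', h1⟩

/-- The cost of a computation depends affinely on the times of its steps. -/
theorem Computation.exists_cost_reage_eq [Fintype P] [DecidableEq P] (π : Computation N n) :
    ∃ (K : ℝ) (W : Fin n → ℝ),
      (π.cost : ℝ) = K + ∑ i, W i * ((π.time i.succ : ℝ) - π.time i.castSucc) ∧
      ∀ (g : CircleDeg1Lift) (hg : StrictMono g),
        ((π.reage hg).cost : ℝ) = K + ∑ i, W i * (g (π.time i.succ) - g (π.time i.castSucc)) := by
  have key : ∀ i : Fin n, ∃ K W : ℝ,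
      (stepCost N (π.conf i.castSucc) (π.label i) : ℝ) =
        K + W * ((π.time i.succ : ℝ) - π.time i.castSucc) ∧
      ∀ (g : CircleDeg1Lift) (hg : StrictMono g),
        (stepCost N ((π.reage hg).conf i.castSucc) ((π.reage hg).label i) : ℝ) =
          K + W * (g (π.time i.succ) - g (π.time i.castSucc)) := by
    intro i
    simp only [π.time_succ, Computation.reage]
    cases π.label i with
    | disc t O => exact ⟨(N.transCost t : ℝ), 0, by simp [stepCost],
        fun g hg => by simp [stepCost, Label.reage]⟩
    | delay x =>
      -- The slope is the price of the marking per time unit; it depends only on token counts, so it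
      -- is the same for every `g`.
      refine ⟨0, ∑ p : P, ((π.conf i.castSucc).2.countP (fun tok => tok.1 = p) : ℝ) *
        (N.placeCost p : ℝ), ?_, fun g hg => ?_⟩
      · simp [stepCost, Label.duration, mul_comm]
      · simp [stepCost, Label.reage, Label.duration, Marking.countP_reage, coe_reage, mul_comm]
  choose K W h₁ h₂ using key
  refine ⟨∑ i, K i, W, ?_, fun g hg => ?_⟩
  · simp only [Computation.cost, NNReal.coe_sum, h₁, Finset.sum_add_distrib]
  · simp only [Computation.cost, NNReal.coe_sum, h₂, Finset.sum_add_distrib]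

end

/-! ### Rounding -/

/-- Round down if the fractional part is at most `θ`, and up otherwise. -/
noncomputable def thresholdRound (θ z : ℝ) : ℤ := ⌊z⌋ + if θ < Int.fract z then 1 else 0

theorem thresholdRound_add_one (θ z : ℝ) : thresholdRound θ (z + 1) = thresholdRound θ z + 1 := by
  simp only [thresholdRound, Int.floor_add_one, Int.fract_add_one]
  ring

/-- Rounding exceeds the floor by at most 1, which a strict increase of the floor absorbs; with
equal floors the fractional parts are ordered. -/
theorem thresholdRound_mono (θ : ℝ) : Monotone (thresholdRound θ) := by
  intro z w h
  unfold thresholdRound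
  rcases (Int.floor_mono h).lt_or_eq with hl | he
  · split_ifs <;> omega
  · have hf : Int.fract z ≤ Int.fract w := by
      rw [Int.fract, Int.fract, he]
      linarith
    split_ifs with h₁ h₂
    · omega
    · exact absurd (h₁.trans_le hf) h₂
    · omega
    · omega

theorem abs_sub_thresholdRound_le (θ z : ℝ) : |z - thresholdRound θ z| ≤ 1 := by
  have h := Int.floor_add_fract z
  have h0 := Int.fract_nonneg z
  have h1 := (Int.fract_lt_one z).le
  rw [abs_le, thresholdRound]
  split_ifs <;> push_cast <;> constructor <;> linarith

open MeasureTheory in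
-- Rounding up happens exactly for `θ < Int.fract z`, a part of `[0, 1)` of length `Int.fract z`.
theorem integrable_thresholdRound (z : ℝ) :
    Integrable (fun θ : ℝ => (thresholdRound θ z : ℝ)) (volume.restrict (Set.Ico 0 1)) ∧
    ∫ θ in Set.Ico (0 : ℝ) 1, (thresholdRound θ z : ℝ) = z := by
  have h : (fun θ : ℝ => (thresholdRound θ z : ℝ)) =
      fun θ => (⌊z⌋ : ℝ) + (Set.Iio (Int.fract z)).indicator (fun _ => (1 : ℝ)) θ := by
    funext θ
    simp [thresholdRound, Set.indicator_apply]
  have hi : Integrable ((Set.Iio (Int.fract z)).indicator fun _ => (1 : ℝ))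
      (volume.restrict (Set.Ico (0 : ℝ) 1)) :=
    (integrable_const 1).indicator measurableSet_Iio
  have hs : Set.Iio (Int.fract z) ∩ Set.Ico 0 1 = Set.Ico 0 (Int.fract z) := by
    ext θ
    have := Int.fract_lt_one z
    simp only [Set.mem_inter_iff, Set.mem_Iio, Set.mem_Ico]
    constructor
    · exact fun h => ⟨h.2.1, h.1⟩
    · exact fun h => ⟨h.2, h.1, h.2.trans this⟩
  rw [h]
  refine ⟨(integrable_const _).add hi, ?_⟩
  rw [integral_add (integrable_const _) hi, integral_indicator_const _ measurableSet_Iio,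
    measureReal_restrict_apply measurableSet_Iio, hs]
  simp [Int.fract_nonneg, Int.floor_add_fract]

open MeasureTheory in
/-- Some threshold does not increase a given linear combination of differences, since the average
over all thresholds preserves it. -/
theorem exists_sum_thresholdRound_le {ι : Type*} [Fintype ι] (W a b : ι → ℝ) :
    ∃ θ : ℝ, ∑ i, W i * ((thresholdRound θ (a i) : ℝ) - thresholdRound θ (b i)) ≤
      ∑ i, W i * (a i - b i) := by
  have : IsProbabilityMeasure (volume.restrict (Set.Ico (0 : ℝ) 1)) := ⟨by simp⟩
  have hi : ∀ i, Integrable (fun θ : ℝ =>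
      W i * ((thresholdRound θ (a i) : ℝ) - thresholdRound θ (b i)))
      (volume.restrict (Set.Ico 0 1)) := fun i =>
    ((integrable_thresholdRound (a i)).1.sub (integrable_thresholdRound (b i)).1).const_mul _
  -- A function is somewhere at most its mean. Nothing is recorded about where `θ` lies, as the
  -- other rounding lemmas hold for all real `θ`.
  obtain ⟨θ, hθ⟩ := exists_le_integral (integrable_finsetSum Finset.univ fun i _ => hi i)
  refine ⟨θ, hθ.trans_eq ?_⟩
  rw [integral_finsetSum _ fun i _ => hi i]
  refine Finset.sum_congr rfl fun i _ => ?_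
  rw [integral_const_mul, integral_sub (integrable_thresholdRound _).1
    (integrable_thresholdRound _).1, (integrable_thresholdRound _).2,
    (integrable_thresholdRound _).2]

/-- The reparametrization that moves each time to within `s` of its rounding. -/
noncomputable def squeeze (θ s : ℝ) (hs : 0 ≤ s) (hs' : s ≤ 1) : CircleDeg1Lift where
  toFun z := s * z + (1 - s) * thresholdRound θ z
  monotone' z w h := by
    have h' : (thresholdRound θ z : ℝ) ≤ thresholdRound θ w := by
      exact_mod_cast thresholdRound_mono θ h
    exact add_le_add (mul_le_mul_of_nonneg_left h hs)
      (mul_le_mul_of_nonneg_left h' (sub_nonneg.2 hs'))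
  map_add_one' z := by
    rw [thresholdRound_add_one]
    push_cast
    ring

theorem squeeze_apply (θ s : ℝ) (hs : 0 ≤ s) (hs' : s ≤ 1) (z : ℝ) :
    squeeze θ s hs hs' z = s * z + (1 - s) * thresholdRound θ z := rfl

theorem squeeze_strictMono (θ s : ℝ) (hs : 0 < s) (hs' : s ≤ 1) :
    StrictMono (squeeze θ s hs.le hs') := by
  intro z w h
  have h' : (thresholdRound θ z : ℝ) ≤ thresholdRound θ w := by
    exact_mod_cast thresholdRound_mono θ h.le
  exact add_lt_add_of_lt_of_le (mul_lt_mul_of_pos_left h hs)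
    (mul_le_mul_of_nonneg_left h' (sub_nonneg.2 hs'))

/-- `squeeze` scales the rounding error, at most 1 in absolute value, by `s`; a difference carries
two such errors. -/
theorem abs_squeeze_sub_squeeze_sub_le (θ s : ℝ) (hs : 0 ≤ s) (hs' : s ≤ 1) (z w : ℝ) :
    |squeeze θ s hs hs' z - squeeze θ s hs hs' w -
      (thresholdRound θ z - thresholdRound θ w : ℤ)| ≤ 2 * s := by
  have hz := abs_le.1 (abs_sub_thresholdRound_le θ z)
  have hw := abs_le.1 (abs_sub_thresholdRound_le θ w)
  have h : squeeze θ s hs hs' z - squeeze θ s hs hs' w -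
      (thresholdRound θ z - thresholdRound θ w : ℤ) =
      s * ((z - thresholdRound θ z) - (w - thresholdRound θ w)) := by
    rw [squeeze_apply, squeeze_apply]
    push_cast
    ring
  rw [h, abs_mul, abs_of_nonneg hs, mul_comm]
  refine mul_le_mul_of_nonneg_right (abs_le.2 ⟨?_, ?_⟩) hs <;> linarith [hz.1, hz.2, hw.1, hw.2]

/-! ### Long delays -/

/-- Extend a computation by one step. -/
def Computation.snoc {N : Net Q P} {n : ℕ} (π : Computation N n) (l : Label N) (c : Config Q P)
    (h : Step N (π.conf (Fin.last n)) l c) : Computation N (n + 1) where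
  conf := Fin.snoc π.conf c
  label := Fin.snoc π.label l
  step i := by
    refine Fin.lastCases ?_ (fun j => ?_) i
    · rw [Fin.succ_last]
      simpa only [Fin.snoc_last, Fin.snoc_castSucc] using h
    · rw [← Fin.castSucc_succ]
      simpa only [Fin.snoc_castSucc] using π.step j

/-- Some computation with delays shorter than `1` leads from `c` to `c'` at cost `v`. -/
def ShortlyReachable [Fintype P] [DecidableEq P] (N : Net Q P) (c : Config Q P) (v : ℝ≥0)
    (c' : Config Q P) : Prop :=
  ∃ (n : ℕ) (π : Computation N n),
    π.conf 0 = c ∧ π.conf (Fin.last n) = c' ∧ π.cost = v ∧ π.ShortDelays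

section

variable [Fintype P] [DecidableEq P] {N : Net Q P}

theorem ShortlyReachable.refl (c : Config Q P) : ShortlyReachable N c 0 c :=
  ⟨0, ⟨fun _ => c, Fin.elim0, fun i => i.elim0⟩, rfl, rfl, by simp [Computation.cost],
    fun i => i.elim0⟩

theorem ShortlyReachable.snoc {c c' c'' : Config Q P} {v : ℝ≥0} {l : Label N}
    (h : ShortlyReachable N c v c') (hl : ∀ x, l = .delay x → x < 1) (hs : Step N c' l c'') :
    ShortlyReachable N c (v + stepCost N c' l) c'' := by
  obtain ⟨n, π, h₀, rfl, rfl, hπ⟩ := h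
  refine ⟨n + 1, π.snoc l c'' hs, ?_, ?_, ?_, ?_⟩
  · rw [← h₀, ← Fin.castSucc_zero]
    exact Fin.snoc_castSucc (α := fun _ => Config Q P) c'' π.conf 0
  · exact Fin.snoc_last (α := fun _ => Config Q P) _ _
  · simp only [Computation.cost, Fin.sum_univ_castSucc, Computation.snoc, Fin.snoc_castSucc,
      Fin.snoc_last]
  · intro i x
    refine Fin.lastCases ?_ (fun j => ?_) i
    · simpa only [Computation.snoc, Fin.snoc_last] using hl x
    · simpa only [Computation.snoc, Fin.snoc_castSucc] using hπ j x

theorem stepCost_age_delay (c : Config Q P) (x y : ℝ≥0) :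
    stepCost N (c.1, c.2.age x) (.delay y) = stepCost N c (.delay y) := by
  simp only [stepCost, Marking.countP_age]

/-- Delays leave the token counts alone, so `k` delays `y` cost as much as one delay `k * y`. For `k
= 0` the latter is only a cost expression, not a step. -/
theorem ShortlyReachable.delays {c c' : Config Q P} {v y : ℝ≥0} (h : ShortlyReachable N c v c')
    (hy : 0 < y) (hy' : y < 1) (k : ℕ) :
    ShortlyReachable N c (v + stepCost N c' (.delay (k * y))) (c'.1, c'.2.age (k * y)) := by
  induction k with
  | zero => simpa [stepCost, Marking.age] using h
  | succ k ih =>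
    have := ih.snoc (l := .delay y) (c'' := (c'.1, c'.2.age ((k + 1 : ℕ) * y)))
      (by rintro x ⟨⟩; exact hy') ⟨hy, rfl, by
        simp only [Marking.age_age]
        congr 1
        push_cast
        ring⟩
    rw [stepCost_age_delay] at this
    convert this using 1
    simp only [stepCost]
    push_cast
    ring

theorem ShortlyReachable.step {c c' c'' : Config Q P} {v : ℝ≥0} {l : Label N}
    (h : ShortlyReachable N c v c') (hs : Step N c' l c'') :
    ShortlyReachable N c (v + stepCost N c' l) c'' := by
  cases l with
  | disc t O => exact h.snoc (by simp) hs
  | delay x =>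
    -- The delay is cut into `k > x` equal pieces `x / k < 1`.
    obtain ⟨k, hk⟩ := exists_nat_gt x
    obtain ⟨hx, h₁, h₂⟩ := hs
    have hk0 : (0 : ℝ≥0) < k := hx.trans hk
    have h' := h.delays (y := x / k) (by positivity) ((div_lt_one hk0).2 hk) k
    rw [mul_div_cancel₀ x hk0.ne'] at h'
    have hc : c'' = (c'.1, c'.2.age x) := Prod.ext h₁ h₂
    rwa [hc]

theorem Computation.shortlyReachable {n : ℕ} (π : Computation N n) :
    ShortlyReachable N (π.conf 0) π.cost (π.conf (Fin.last n)) := by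
  have key : ∀ i : Fin (n + 1), ShortlyReachable N (π.conf 0)
      (Fin.partialSum (fun i => stepCost N (π.conf i.castSucc) (π.label i)) i) (π.conf i) := by
    intro i
    induction i using Fin.induction with
    | zero => simpa using ShortlyReachable.refl _
    | succ i ih =>
      rw [Fin.partialSum_succ]
      exact ih.step (π.step i)
  have h := key (Fin.last n)
  simpa [Fin.partialSum, List.sum_ofFn, List.take_of_length_le, Computation.cost] using h

end

/-- Every reaching computation can be brought into long `δ`-form without increasing its cost. -/
theorem Computation.exists_isLongDeltaForm [Fintype P] [DecidableEq P] {N : Net Q P}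
    {qinit qfin : Q} {δ : ℝ} (hδ : 0 < δ) {n : ℕ} (π : Computation N n)
    (hπ : π.Reaches qinit qfin) :
    ∃ π' : Computation N n,
      π'.Reaches qinit qfin ∧
      π'.IsLongDeltaForm δ ∧
      (π.ShortDelays ∨ π.Detailed → π'.IsDeltaForm δ) ∧
      π'.cost ≤ π.cost ∧
      (∀ i : Fin (n + 1), (π'.conf i).2.card = (π.conf i).2.card) ∧
      (π.Detailed → π'.Detailed) := by
  obtain ⟨K, W, h₁, h₂⟩ := π.exists_cost_reage_eq
  obtain ⟨θ, hθ⟩ := exists_sum_thresholdRound_le W (fun i => (π.time i.succ : ℝ))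
    fun i => (π.time i.castSucc : ℝ)
  -- `δ / 2` because differences of `squeeze` values are within `2 * s` of integers.
  obtain ⟨s, hs, hs'⟩ : ∃ s : ℝ, 0 < s ∧ s < min 1 (δ / 2) := exists_between (by positivity)
  have hs1 : s ≤ 1 := (hs'.trans_le (min_le_left _ _)).le
  have hsδ : 2 * s < δ := by linarith [hs'.trans_le (min_le_right _ _)]
  have hg := squeeze_strictMono θ s hs hs1
  have hl : (π.reage hg).IsLongDeltaForm δ := Computation.isLongDeltaForm_reage hg fun z w =>
    ⟨_, (abs_squeeze_sub_squeeze_sub_le θ s hs.le hs1 z w).trans_lt hsδ⟩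
  refine ⟨π.reage hg, hπ.reage hg, hl, fun h => hl.isDeltaForm ?_, ?_,
    fun i => Marking.card_reage _ _ _, fun h => h.reage hg⟩
  · exact (h.elim id fun h => h.shortDelays).reage hg
  · rw [← NNReal.coe_le_coe, h₁, h₂ _ hg]
    -- The variable cost is a convex combination of the original one and the rounded one, which is
    -- no larger by `hθ`.
    have h₃ : ∑ i, W i * (squeeze θ s hs.le hs1 (π.time i.succ) -
          squeeze θ s hs.le hs1 (π.time i.castSucc)) =
        s * (∑ i, W i * ((π.time i.succ : ℝ) - π.time i.castSucc)) +
        (1 - s) * ∑ i, W i * ((thresholdRound θ (π.time i.succ) : ℝ) -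
          thresholdRound θ (π.time i.castSucc)) := by
      rw [Finset.mul_sum, Finset.mul_sum, ← Finset.sum_add_distrib]
      refine Finset.sum_congr rfl fun i _ => ?_
      rw [squeeze_apply, squeeze_apply]
      ring
    rw [h₃]
    nlinarith [mul_le_mul_of_nonneg_left hθ (sub_nonneg.2 hs1)]

end PTPN

theorem mainTheorem4 {Q P : Type*} [Finite Q] [Fintype P] [DecidableEq P]
    (N : PTPN.Net Q P) (qinit qfin : Q) (δ : ℝ) (hδ : 0 < δ) :
    (∀ (n : ℕ) (π : PTPN.Computation N n), π.Reaches qinit qfin →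
      ∃ π' : PTPN.Computation N n,
        π'.Reaches qinit qfin ∧
        π'.IsLongDeltaForm δ ∧
        (π.ShortDelays ∨ π.Detailed → π'.IsDeltaForm δ) ∧
        π'.cost ≤ π.cost ∧
        (∀ i : Fin (n + 1), (π'.conf i).2.card = (π.conf i).2.card) ∧
        (π.Detailed → π'.Detailed)) ∧
    PTPN.optCost N qinit qfin =
      sInf {v : ENNReal | ∃ (n : ℕ) (π : PTPN.Computation N n),
        π.Reaches qinit qfin ∧ π.IsDeltaForm δ ∧ v = (π.cost : ENNReal)} := by
  refine ⟨fun n π hπ => PTPN.Computation.exists_isLongDeltaForm hδ π hπ, le_antisymm ?_ ?_⟩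
  · refine sInf_le_sInf ?_
    rintro v ⟨n, π, hπ, -, rfl⟩
    exact ⟨n, π, hπ, le_rfl⟩
  · refine le_sInf ?_
    rintro v ⟨n, π, hπ, hv⟩
    -- Cutting precedes rounding, since the first part yields `δ`-form only from short delays.
    obtain ⟨m, ρ, h₀, hl, hc, hs⟩ := π.shortlyReachable
    have hρ : ρ.Reaches qinit qfin := ⟨h₀.trans hπ.1, by rw [hl]; exact hπ.2⟩
    obtain ⟨ρ', hr, -, hd, hle, -⟩ := PTPN.Computation.exists_isLongDeltaForm hδ ρ hρ
    refine sInf_le_of_le ⟨m, ρ', hr, hd (.inl hs), rfl⟩ (le_trans ?_ hv)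
    rw [← hc]
    exact_mod_cast hle
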